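/- Let $S=K[t_1,\ldots,t_s]$ be a polynomial ring over a finite field $K$ with the standard grading, let $\mathfrak{m}=(t_1,\ldots,t_s)$, and let $\prec$ be a graded monomial order on $S$ (monomials are first compared by total degree). Let $\mathbb{X}=\{[P_1],\ldots,[P_m]\}$ be a set of $m\ge 2$ distinct points of the projective space $\mathbb{P}^{s-1}$ over $K$, and let $I=I(\mathbb{X})$ be its graded vanishing ideal, generated by the homogeneous polynomials vanishing at all points of $\mathbb{X}$. Let $b_{i,j}$ be the graded Betti numbers of $S/I$, that is, $\bigoplus_j S(-j)^{b_{i,j}}$ is the $i$-th module of the minimal graded free resolution of $S/I$ over $S$; let $g=\max\{i\mid b_{i,j}\neq 0\text{ for some }j\}$ be the projective dimension of $S/I$, and let $r_0=\max\{j-i\mid b_{i,j}\ne 0\}$ be the Castelnuovo--Mumford regularity of $S/I$. The ideal $I$ is called Gorenstein if there is a unique $j$ with $b_{g,j}\neq 0$ and, for this $j$, $b_{g,j}=1$. For a graded ideal $L$ of $S$ let $\Delta_\prec(L)$ be the set of standard monomials of $S/L$, that is, the monomials not in the initial ideal ${\rm in}_\prec(L)$, let $\Delta_\prec(L)_d$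 be the set of those of degree $d$, and let $K\Delta_\prec(L)$ be the $K$-linear span of $\Delta_\prec(L)$. The remainder on division of $f\in S$ by $L$ is the unique $r_f\in K\Delta_\prec(L)$ with $f-r_f\in L$. For each $i$ let $\mathfrak{p}_i$ be the vanishing ideal of $[P_i]$, let ${\rm v}_{\mathfrak{p}_i}(I)$ be the least $d\ge 0$ such that $(I\colon f)=\mathfrak{p}_i$ for some homogeneous $f$ of degree $d$, and let $f_i$ be the $i$-th standard indicator function of $\mathbb{X}$, that is, the (unique up to a nonzero scalar) homogeneous polynomial $f_i\in K\Delta_\prec(I)$ of degree ${\rm v}_{\mathfrak{p}_i}(I)$ with $f_i(P_i)\ne 0$ and $f_i(P_j)=0$ for all $j\neq i$. Let $h$ be a homogeneous polynomial of degree $1$ that is regular on $S/I$, let $J=(I,h)$, and let ${\rm Soc}(S/J)=(J\colon\mathfrak{m})/J$. If $I$ is Gorenstein, then there is a monomial $t^a$ such that $\Delta_\prec(J)_{r_0}=\{t^a\}$, and for every $i=1,\ldots,m$ one has $\deg(f_i)=r_0$, $${\rm Soc}(S/J)=K(f_i+J)=K(t^a+J),$$ and the remainder on division of $f_i$ by $J$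 is $r_{f_i}=\lambda_i t^a$ for some $\lambda_i\in K\setminus\{0\}$. -/

import Mathlib

open scoped LinearAlgebra.Projectivization

noncomputable section

namespace ProjPoints

open MvPolynomial

variable {K : Type*} [Field K] {s m : ℕ}

/-! ### Points of projective space and their vanishing ideals -/

/-- The graded vanishing ideal of a set `X` of points of the projective space of dimension `s - 1`:
the ideal generated by the homogeneous polynomials that vanish at all points of `X`. The vanishing
of a homogeneous polynomial does not depend on the chosen representative. -/
def vanishingIdeal (X : Set (ℙ K (Fin s → K))) : Ideal (MvPolynomial (Fin s) K) :=
  Ideal.span {f | (∃ d, f.IsHomogeneous d) ∧ ∀ p ∈ X, eval p.rep f = 0}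

/-- The local v-number of `I` at `𝔭`: the least `d` such that `(I : f) = 𝔭` for some form `f` of
degree `d`. -/
def vNumber (I 𝔭 : Ideal (MvPolynomial (Fin s) K)) : ℕ :=
  sInf {d | ∃ f : MvPolynomial (Fin s) K, f.IsHomogeneous d ∧ Submodule.colon I {f} = 𝔭}

/-- `f` is an indicator function of the `i`-th point of the family `P`. -/
def IsIndicator (P : Fin m → ℙ K (Fin s → K)) (i : Fin m) (f : MvPolynomial (Fin s) K) : Prop :=
  (∃ d, f.IsHomogeneous d) ∧ eval (P i).rep f ≠ 0 ∧ ∀ j, j ≠ i → eval (P j).rep f = 0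

/-! ### Initial ideals, footprints and remainders -/

/-- A monomial order is graded if monomials are first compared by their total degrees. -/
def IsGradedOrder (ord : MonomialOrder (Fin s)) : Prop :=
  ∀ a b : Fin s →₀ ℕ, a.degree < b.degree → ord.toSyn a < ord.toSyn b

/-- The initial ideal, generated by the initial monomials of the nonzero elements of `I`. -/
def initialIdeal (ord : MonomialOrder (Fin s)) (I : Ideal (MvPolynomial (Fin s) K)) :
    Ideal (MvPolynomial (Fin s) K) :=
  Ideal.span {u | ∃ f ∈ I, f ≠ 0 ∧ u = monomial (ord.degree f) 1}

/-- The footprint of `S/I`: the (exponents of the) monomials that are not in the initial ideal. -/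
def footprint (ord : MonomialOrder (Fin s)) (I : Ideal (MvPolynomial (Fin s) K)) :
    Set (Fin s →₀ ℕ) :=
  {a | monomial a (1 : K) ∉ initialIdeal ord I}

/-- The standard monomials of degree `d`. -/
def footprintDeg (ord : MonomialOrder (Fin s)) (I : Ideal (MvPolynomial (Fin s) K)) (d : ℕ) :
    Set (Fin s →₀ ℕ) :=
  {a | a ∈ footprint ord I ∧ a.degree = d}

/-- The `K`-linear span of the standard monomials. -/
def standardSpan (ord : MonomialOrder (Fin s)) (I : Ideal (MvPolynomial (Fin s) K)) :
    Submodule K (MvPolynomial (Fin s) K) :=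
  Submodule.span K ((fun a => monomial a (1 : K)) '' footprint ord I)

/-- `r` is a remainder on division of `f` by `I`: it lies in the span of the standard monomials
and `f = g + r` for some `g ∈ I`. -/
def IsRemainder (ord : MonomialOrder (Fin s)) (I : Ideal (MvPolynomial (Fin s) K))
    (f r : MvPolynomial (Fin s) K) : Prop :=
  r ∈ standardSpan ord I ∧ ∃ g ∈ I, f = g + r

/-- `f` is the standard indicator function of the `i`-th point of the family `P` (it is unique up
to a nonzero scalar): an indicator function that is a combination of standard monomials of `S/I`,
where `I` is the vanishing ideal of all the points, and whose degree is the v-number of `I` at the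
vanishing ideal of the `i`-th point. -/
def IsStandardIndicator (ord : MonomialOrder (Fin s)) (P : Fin m → ℙ K (Fin s → K)) (i : Fin m)
    (f : MvPolynomial (Fin s) K) : Prop :=
  IsIndicator P i f ∧ f ∈ standardSpan ord (vanishingIdeal (Set.range P)) ∧
    f.totalDegree = vNumber (vanishingIdeal (Set.range P)) (vanishingIdeal {P i})

/-! ### Minimal graded free resolutions, Betti numbers, regularity, Gorenstein ideals -/

/-- A (finite) minimal graded free resolution
`⋯ → F₂ → F₁ → F₀ = S → S/I → 0` of `S/I` for a proper graded ideal `I`, given by matrices: `Fᵢ` is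
the direct sum of the `S(-shift i k)` for `k < rank i`, and `d i` is the matrix of the map from
`Fᵢ₊₁` to `Fᵢ`. -/
structure MinGradedFreeResolution (I : Ideal (MvPolynomial (Fin s) K)) where
  rank : ℕ → ℕ
  shift : (i : ℕ) → Fin (rank i) → ℕ
  d : (i : ℕ) → Matrix (Fin (rank i)) (Fin (rank (i + 1))) (MvPolynomial (Fin s) K)
  /-- The length is finite. -/
  finite : ∃ N, ∀ i, N < i → rank i = 0
  /-- `F₀ = S`. -/
  rank_zero : rank 0 = 1
  shift_zero : ∀ k, shift 0 k = 0
  /-- The maps are homogeneous of degree zero. -/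
  homogeneous : ∀ i l k, d i l k ≠ 0 → shift i l ≤ shift (i + 1) k ∧
    (d i l k).IsHomogeneous (shift (i + 1) k - shift i l)
  /-- Minimality: all entries of the matrices are in the ideal generated by the variables. -/
  minimal : ∀ i l k, d i l k ∈ idealOfVars (Fin s) K
  /-- Exactness at `F₀ = S`: the image of `F₁` is `I`. -/
  exact_zero : ∀ f : MvPolynomial (Fin s) K, f ∈ I ↔ ∃ v, (d 0).mulVec v = fun _ => f
  /-- Exactness at `Fᵢ₊₁`. -/
  exact_succ : ∀ i v, (d i).mulVec v = 0 ↔ ∃ w, (d (i + 1)).mulVec w = v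

open Classical in
/-- The graded Betti number `b_{i,j}` of `S/I`: the number of summands `S(-j)` in the `i`-th
module of the minimal graded free resolution of `S/I`. As this resolution is unique up to
isomorphism, the choice does not matter. -/
def gradedBetti (I : Ideal (MvPolynomial (Fin s) K)) (i j : ℕ) : ℕ :=
  if h : Nonempty (MinGradedFreeResolution I) then
    (Finset.univ.filter fun k => h.some.shift i k = j).card
  else 0

/-- The projective dimension of `S/I`: the length of the minimal graded free resolution. -/
def projDim (I : Ideal (MvPolynomial (Fin s) K)) : ℕ :=
  sSup {i | ∃ j, gradedBetti I i j ≠ 0}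

/-- The Castelnuovo-Mumford regularity of `S/I`: the maximum of `j - i` over all `i`, `j` with
`b_{i,j} ≠ 0` (for these one has `i ≤ j`). -/
def regularity (I : Ideal (MvPolynomial (Fin s) K)) : ℕ :=
  sSup {n | ∃ i j, gradedBetti I i j ≠ 0 ∧ i + n = j}

/-- `S/I` is level: the last module of the minimal graded free resolution is generated in a single
degree. -/
def IsLevel (I : Ideal (MvPolynomial (Fin s) K)) : Prop :=
  ∃! j, gradedBetti I (projDim I) j ≠ 0

/-- `I` is Gorenstein: `S/I` is level and the only nonzero last graded Betti number is one. -/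
def IsGorenstein (I : Ideal (MvPolynomial (Fin s) K)) : Prop :=
  IsLevel I ∧ ∀ j, gradedBetti I (projDim I) j ≠ 0 → gradedBetti I (projDim I) j = 1

/-! ### The socle -/

/-- The socle `(J : 𝔪)/J` of `S/J`, where `𝔪` is the ideal generated by the variables. -/
def socle (J : Ideal (MvPolynomial (Fin s) K)) : Ideal (MvPolynomial (Fin s) K ⧸ J) :=
  Ideal.map (Ideal.Quotient.mk J)
    (Submodule.colon J (idealOfVars (Fin s) K : Set (MvPolynomial (Fin s) K)))

end ProjPoints

end

/-!
Complete `h` to a basis `h, l₁, …, lₙ` of the linear forms and let `F` be the minimal graded free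
resolution of `S/I`. Dividing `F` by these forms one after another, the connecting maps of the long
exact homology sequences send a form `f` with `lₖ f ∈ J` for all `k` to an element of `Fₙ / 𝔪 Fₙ`,
which is zero only if `f ∈ J`. So a form of degree `d` that represents a nonzero element of
`Soc(S/J)` yields a summand `S(-d-n)` of `Fₙ`, and linearly independent elements of the socle yield
linearly independent vectors of constants. If `I` is Gorenstein, `Fₙ` has rank one, whence the socle
is one-dimensional and lives in a single degree.

Each `fᵢ` represents an element of the socle, because `(tₖ - (tₖ(Pᵢ)/h(Pᵢ)) h) fᵢ` vanishes at all
points. It is not in `J`: if `fᵢ = h w` at all points, then `w` is an indicator function of degree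
smaller than the v-number. Interpolation with the `fᵢ` shows that `S/J` vanishes in the degrees
above the largest `deg fᵢ`, which is therefore the regularity of `S/I`.
-/

namespace ProjPoints

open MvPolynomial

variable {K : Type*} [Field K] {s : ℕ}

/-- The `K`-space of forms of degree `n`. The grading is indexed by `ℤ` (with `forms n = 0` for
`n < 0`), so that degrees can be shifted down without side conditions. -/
abbrev forms (n : ℤ) : Submodule K (MvPolynomial (Fin s) K) :=
  weightedHomogeneousSubmodule K 1 n

noncomputable instance : GradedAlgebra (forms : ℤ → Submodule K (MvPolynomial (Fin s) K)) :=
  weightedGradedAlgebra K 1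

theorem weight_one_eq_degree (a : Fin s →₀ ℕ) : Finsupp.weight (1 : Fin s → ℤ) a = a.degree := by
  simp [Finsupp.weight_eq_sum, Finsupp.degree_eq_sum]

theorem mem_forms_iff {n : ℤ} {p : MvPolynomial (Fin s) K} :
    p ∈ forms n ↔ ∀ a, coeff a p ≠ 0 → (a.degree : ℤ) = n := by
  simp only [mem_weightedHomogeneousSubmodule, IsWeightedHomogeneous, weight_one_eq_degree]

theorem mem_forms_natCast {n : ℕ} {p : MvPolynomial (Fin s) K} :
    p ∈ forms (n : ℤ) ↔ p.IsHomogeneous n := by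
  simp only [mem_forms_iff, Nat.cast_inj, Finsupp.degree_eq_weight_one]
  rfl

theorem C_mem_forms_zero (c : K) : C c ∈ forms (s := s) 0 :=
  isWeightedHomogeneous_C 1 c

theorem monomial_mem_forms {a : Fin s →₀ ℕ} {d : ℕ} (ha : a.degree = d) (c : K) :
    monomial a c ∈ forms (d : ℤ) :=
  mem_forms_natCast.2 (isHomogeneous_monomial c ha)

theorem X_mem_forms_one (i : Fin s) : (X i : MvPolynomial (Fin s) K) ∈ forms 1 :=
  isWeightedHomogeneous_X K 1 i

theorem eq_zero_of_mem_forms_of_neg {n : ℤ} (hn : n < 0) {p : MvPolynomial (Fin s) K}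
    (hp : p ∈ forms n) : p = 0 := by
  ext a
  by_contra ha
  have := mem_forms_iff.1 hp a ha
  omega

theorem coeff_proj_forms (n : ℤ) (p : MvPolynomial (Fin s) K) (a : Fin s →₀ ℕ) :
    coeff a (GradedAlgebra.proj forms n p) = if (a.degree : ℤ) = n then coeff a p else 0 := by
  classical
  rw [← weight_one_eq_degree, ← coeff_weightedHomogeneousComponent]
  exact congrArg (coeff a) (weightedDecomposition.decompose'_apply K 1 p n)

theorem exists_isHomogeneous_of_mem_forms {n : ℤ} {p : MvPolynomial (Fin s) K}
    (hp : p ∈ forms n) : ∃ d, p.IsHomogeneous d := by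
  obtain hn | hn := lt_or_ge n 0
  · exact ⟨0, eq_zero_of_mem_forms_of_neg hn hp ▸ isHomogeneous_zero _ _ _⟩
  · lift n to ℕ using hn
    exact ⟨n, mem_forms_natCast.1 hp⟩

theorem proj_forms_of_mem {n : ℤ} {p : MvPolynomial (Fin s) K} (hp : p ∈ forms n) :
    GradedAlgebra.proj forms n p = p :=
  DirectSum.decompose_of_mem_same forms hp

theorem proj_forms_eq_zero {n n' : ℤ} {p : MvPolynomial (Fin s) K} (hp : p ∈ forms n)
    (hn : n ≠ n') : GradedAlgebra.proj forms n' p = 0 :=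
  DirectSum.decompose_of_mem_ne forms hp hn

theorem proj_forms_mem (n : ℤ) (p : MvPolynomial (Fin s) K) :
    GradedAlgebra.proj forms n p ∈ forms n :=
  SetLike.coe_mem _

theorem proj_forms_mul {e : ℤ} {p : MvPolynomial (Fin s) K} (hp : p ∈ forms e) (n : ℤ)
    (q : MvPolynomial (Fin s) K) :
    GradedAlgebra.proj forms n (p * q) = p * GradedAlgebra.proj forms (n - e) q := by
  have h := DirectSum.coe_decompose_mul_add_of_left_mem forms (j := n - e) (b := q) hp
  rwa [add_sub_cancel] at h

theorem isHomogeneous_span_singleton {n : ℤ} {p : MvPolynomial (Fin s) K} (hp : p ∈ forms n) :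
    (Ideal.span {p}).IsHomogeneous forms :=
  Ideal.homogeneous_span _ _ (by rintro _ rfl; exact ⟨n, hp⟩)

theorem mem_idealOfVars_iff {p : MvPolynomial (Fin s) K} :
    p ∈ idealOfVars (Fin s) K ↔ coeff 0 p = 0 := by
  rw [← pow_one (idealOfVars (Fin s) K), mem_pow_idealOfVars_iff']
  simp only [Nat.lt_one_iff, Finsupp.degree_eq_zero_iff, forall_eq]

theorem eq_zero_of_mem_forms_of_notMem_idealOfVars {n : ℤ} {p : MvPolynomial (Fin s) K}
    (hp : p ∈ forms n) (hp' : p ∉ idealOfVars (Fin s) K) : n = 0 := by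
  simpa using (mem_forms_iff.1 hp 0 (mt mem_idealOfVars_iff.2 hp')).symm

theorem exists_mem_forms_sub_mul_mem {I : Ideal (MvPolynomial (Fin s) K)}
    (hI : I.IsHomogeneous forms) {e n : ℤ} {h g : MvPolynomial (Fin s) K} (hh : h ∈ forms e)
    (hg : g ∈ forms n) (hmem : g ∈ I ⊔ Ideal.span {h}) : ∃ w ∈ forms (n - e), g - h * w ∈ I := by
  rw [sup_comm, Ideal.mem_span_singleton_sup] at hmem
  obtain ⟨w, x, hx, hwx⟩ := hmem
  refine ⟨_, proj_forms_mem (n - e) w, ?_⟩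
  have hproj : GradedAlgebra.proj forms n x ∈ I := hI n hx
  rwa [eq_sub_of_add_eq' hwx, map_sub, proj_forms_of_mem hg, mul_comm w, proj_forms_mul hh]
    at hproj

namespace MinGradedFreeResolution

variable {I : Ideal (MvPolynomial (Fin s) K)} (F : MinGradedFreeResolution I)

/-- The `i`-th free module `Fᵢ` of the resolution. -/
abbrev Term (i : ℕ) : Type _ := Fin (F.rank i) → MvPolynomial (Fin s) K

/-- The differential `Fᵢ₊₁ → Fᵢ` of the resolution. -/
noncomputable def differential (i : ℕ) : F.Term (i + 1) →ₗ[MvPolynomial (Fin s) K] F.Term i :=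
  (F.d i).mulVecLin

/-- The `K`-space of the homogeneous elements of degree `j` of `Fᵢ = ⨁ S(-shift i k)`. -/
noncomputable def degreePart (i : ℕ) (j : ℤ) : Submodule K (F.Term i) :=
  Submodule.pi Set.univ fun k => forms (j - F.shift i k)

/-- The submodule `L Fᵢ` of `Fᵢ`. -/
noncomputable def multiples (L : Ideal (MvPolynomial (Fin s) K)) (i : ℕ) :
    Submodule (MvPolynomial (Fin s) K) (F.Term i) :=
  Submodule.pi Set.univ fun _ => L

/-- The elements of `Fᵢ` that represent cycles of the complex `F / L F`. -/
noncomputable def cycles (L : Ideal (MvPolynomial (Fin s) K)) :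
    (i : ℕ) → Submodule (MvPolynomial (Fin s) K) (F.Term i)
  | 0 => ⊤
  | i + 1 => (F.multiples L i).comap (F.differential i)

/-- The elements of `Fᵢ` that represent boundaries of the complex `F / L F`. -/
noncomputable def boundaries (L : Ideal (MvPolynomial (Fin s) K)) (i : ℕ) :
    Submodule (MvPolynomial (Fin s) K) (F.Term i) :=
  LinearMap.range (F.differential i) ⊔ F.multiples L i

/-- The homology of `F / L F`, which is `Tor (S/I, S/L)` if `L` is generated by a regular sequence
on `S`, vanishes in homological degree `i` and internal degree `j`. -/
def HomologyVanishes (L : Ideal (MvPolynomial (Fin s) K)) (i : ℕ) (j : ℤ) : Prop :=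
  ∀ v ∈ F.degreePart i j, v ∈ F.cycles L i → v ∈ F.boundaries L i

variable {F} {L : Ideal (MvPolynomial (Fin s) K)} {l : MvPolynomial (Fin s) K}

theorem differential_apply (i : ℕ) (v : F.Term (i + 1)) (k : Fin (F.rank i)) :
    F.differential i v k = ∑ k', F.d i k k' * v k' := rfl

theorem mem_degreePart {i : ℕ} {j : ℤ} {v : F.Term i} :
    v ∈ F.degreePart i j ↔ ∀ k, v k ∈ forms (j - F.shift i k) := by
  simp [degreePart]

theorem mem_multiples {i : ℕ} {v : F.Term i} : v ∈ F.multiples L i ↔ ∀ k, v k ∈ L := by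
  simp [multiples]

theorem mem_boundaries {i : ℕ} {v : F.Term i} :
    v ∈ F.boundaries L i ↔ ∃ u, v - F.differential i u ∈ F.multiples L i := by
  rw [boundaries, Submodule.mem_sup]
  constructor
  · rintro ⟨_, ⟨u, rfl⟩, x, hx, rfl⟩
    exact ⟨u, by rwa [add_sub_cancel_left]⟩
  · rintro ⟨u, hu⟩
    exact ⟨_, ⟨u, rfl⟩, _, hu, add_sub_cancel _ _⟩

theorem multiples_mono {M : Ideal (MvPolynomial (Fin s) K)} (hLM : L ≤ M) (i : ℕ) :
    F.multiples L i ≤ F.multiples M i :=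
  Submodule.pi_mono fun _ _ => hLM

theorem boundaries_mono {M : Ideal (MvPolynomial (Fin s) K)} (hLM : L ≤ M) (i : ℕ) :
    F.boundaries L i ≤ F.boundaries M i :=
  sup_le_sup_left (multiples_mono hLM i) _

theorem smul_mem_multiples (i : ℕ) (hl : l ∈ L) (v : F.Term i) : l • v ∈ F.multiples L i :=
  mem_multiples.2 fun _ => L.mul_mem_right _ hl

theorem differential_mem_multiples {i : ℕ} {v : F.Term (i + 1)} (hv : v ∈ F.multiples L (i + 1)) :
    F.differential i v ∈ F.multiples L i :=
  mem_multiples.2 fun k => by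
    rw [differential_apply]
    exact Ideal.sum_mem L fun k' _ => L.mul_mem_left _ (mem_multiples.1 hv k')

theorem differential_differential (i : ℕ) (v : F.Term (i + 2)) :
    F.differential i (F.differential (i + 1) v) = 0 :=
  (F.exact_succ i _).2 ⟨v, rfl⟩

noncomputable instance : Unique (Fin (F.rank 0)) := (finCongr F.rank_zero).unique

theorem differential_zero_mem (u : F.Term 1) (k : Fin (F.rank 0)) : F.differential 0 u k ∈ I :=
  (F.exact_zero _).2 ⟨u, funext fun k' => by rw [Subsingleton.elim k' k]; rfl⟩

theorem mem_boundaries_zero {v : F.Term 0} :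
    v ∈ F.boundaries L 0 ↔ ∀ k, v k ∈ I ⊔ L := by
  constructor
  · intro hv k
    obtain ⟨u, hu⟩ := mem_boundaries.1 hv
    simpa using add_mem (Ideal.mem_sup_left (differential_zero_mem u k))
      (Ideal.mem_sup_right (mem_multiples.1 hu k))
  · intro hv
    obtain ⟨a, ha, q, hq, haq⟩ := Submodule.mem_sup.1 (hv default)
    obtain ⟨u, hu⟩ := (F.exact_zero a).1 ha
    refine mem_boundaries.2 ⟨u, mem_multiples.2 fun k => ?_⟩
    have hk : F.differential 0 u k = a := congrFun hu k
    rwa [Pi.sub_apply, hk, Unique.eq_default k, ← haq, add_sub_cancel_left]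

theorem smul_mem_degreePart {i : ℕ} {j e : ℤ} (hl : l ∈ forms e) {v : F.Term i}
    (hv : v ∈ F.degreePart i j) : l • v ∈ F.degreePart i (j + e) := by
  refine mem_degreePart.2 fun k => ?_
  have h := SetLike.GradedMul.mul_mem hl (mem_degreePart.1 hv k)
  rwa [add_sub_left_comm, ← add_sub_assoc] at h

theorem exists_sub_smul_mem_multiples {i : ℕ} {v : F.Term i}
    (hv : v ∈ F.multiples (L ⊔ Ideal.span {l}) i) : ∃ w, v - l • w ∈ F.multiples L i := by
  have hentry (k) : ∃ y, v k - l * y ∈ L := by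
    obtain ⟨x, hx, y, hy, hxy⟩ := Submodule.mem_sup.1 (mem_multiples.1 hv k)
    obtain ⟨z, rfl⟩ := Ideal.mem_span_singleton.1 hy
    exact ⟨z, by rwa [← hxy, add_sub_cancel_right]⟩
  choose w hw using hentry
  exact ⟨w, mem_multiples.2 hw⟩

/-- The projection of `Fᵢ` onto its homogeneous elements of degree `j`. -/
noncomputable def component (F : MinGradedFreeResolution I) (i : ℕ) (j : ℤ) :
    F.Term i →ₗ[K] F.Term i :=
  LinearMap.pi fun k => GradedAlgebra.proj forms (j - F.shift i k) ∘ₗ LinearMap.proj k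

theorem component_apply (i : ℕ) (j : ℤ) (v : F.Term i) (k : Fin (F.rank i)) :
    F.component i j v k = GradedAlgebra.proj forms (j - F.shift i k) (v k) := rfl

theorem component_mem_degreePart (i : ℕ) (j : ℤ) (v : F.Term i) :
    F.component i j v ∈ F.degreePart i j :=
  mem_degreePart.2 fun _ => proj_forms_mem _ _

theorem component_eq_self {i : ℕ} {j : ℤ} {v : F.Term i} (hv : v ∈ F.degreePart i j) :
    F.component i j v = v :=
  funext fun k => proj_forms_of_mem (mem_degreePart.1 hv k)

theorem component_mem_multiples (hL : L.IsHomogeneous forms) {i : ℕ} (j : ℤ) {v : F.Term i}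
    (hv : v ∈ F.multiples L i) : F.component i j v ∈ F.multiples L i :=
  mem_multiples.2 fun k => hL _ (mem_multiples.1 hv k)

theorem component_smul {e : ℤ} (hl : l ∈ forms e) (i : ℕ) (j : ℤ) (v : F.Term i) :
    F.component i j (l • v) = l • F.component i (j - e) v := by
  funext k
  simp only [component_apply, Pi.smul_apply, smul_eq_mul, proj_forms_mul hl, sub_right_comm]

theorem component_differential (i : ℕ) (j : ℤ) (v : F.Term (i + 1)) :
    F.component i j (F.differential i v) = F.differential i (F.component (i + 1) j v) := by
  funext k
  simp only [component_apply, differential_apply, map_sum]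
  refine Finset.sum_congr rfl fun k' _ => ?_
  by_cases h0 : F.d i k k' = 0
  · simp [h0]
  obtain ⟨hle, hd⟩ := F.homogeneous i k k' h0
  rw [proj_forms_mul (mem_forms_natCast.2 hd), Nat.cast_sub hle, sub_sub, add_sub_cancel]

theorem exists_mem_degreePart_sub_differential_mem (hL : L.IsHomogeneous forms) {i : ℕ} {j : ℤ}
    {v : F.Term i} (hv : v ∈ F.degreePart i j) (hb : v ∈ F.boundaries L i) :
    ∃ u ∈ F.degreePart (i + 1) j, v - F.differential i u ∈ F.multiples L i := by
  obtain ⟨u, hu⟩ := mem_boundaries.1 hb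
  refine ⟨F.component (i + 1) j u, component_mem_degreePart _ _ _, ?_⟩
  rw [← component_differential, ← component_eq_self hv, ← map_sub]
  exact component_mem_multiples hL j hu

theorem exists_mem_degreePart_sub_smul_mem (hL : L.IsHomogeneous forms) (hl : l ∈ forms 1) {i : ℕ}
    {j : ℤ} {v : F.Term i} (hv : v ∈ F.degreePart i j)
    (hvl : v ∈ F.multiples (L ⊔ Ideal.span {l}) i) :
    ∃ w ∈ F.degreePart i (j - 1), v - l • w ∈ F.multiples L i := by
  obtain ⟨w, hw⟩ := exists_sub_smul_mem_multiples hvl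
  refine ⟨F.component i (j - 1) w, component_mem_degreePart _ _ _, ?_⟩
  rw [← component_smul hl, ← component_eq_self hv, ← map_sub]
  exact component_mem_multiples hL j hw

theorem differential_mem_degreePart {i : ℕ} {j : ℤ} {v : F.Term (i + 1)}
    (hv : v ∈ F.degreePart (i + 1) j) : F.differential i v ∈ F.degreePart i j := by
  rw [← component_eq_self hv, ← component_differential]
  exact component_mem_degreePart _ _ _

theorem mem_multiples_of_smul_mem (hreg : ∀ x, l * x ∈ L → x ∈ L) {i : ℕ} {v : F.Term i}
    (hv : l • v ∈ F.multiples L i) : v ∈ F.multiples L i :=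
  mem_multiples.2 fun k => hreg _ (mem_multiples.1 hv k)

theorem mem_cycles_of_differential_sub_smul_mem (hreg : ∀ x, l * x ∈ L → x ∈ L) {i : ℕ}
    {v : F.Term (i + 1)} {w : F.Term i}
    (hvw : F.differential i v - l • w ∈ F.multiples L i) : w ∈ F.cycles L i := by
  match i with
  | 0 => trivial
  | i + 1 =>
    refine mem_multiples_of_smul_mem hreg ?_
    have h := neg_mem (differential_mem_multiples hvw)
    rwa [map_sub, differential_differential, map_smul, zero_sub, neg_neg] at h

theorem mem_boundaries_sup_of_differential_sub_smul_mem (hL : L.IsHomogeneous forms)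
    (hl : l ∈ forms 1) {i : ℕ} {j : ℤ} (hvan : F.HomologyVanishes L (i + 1) j)
    {v : F.Term (i + 1)} (hv : v ∈ F.degreePart (i + 1) j)
    {w : F.Term i} (hw : w ∈ F.degreePart i (j - 1))
    (hvw : F.differential i v - l • w ∈ F.multiples L i) (hb : w ∈ F.boundaries L i) :
    v ∈ F.boundaries (L ⊔ Ideal.span {l}) (i + 1) := by
  obtain ⟨x, hx, hwx⟩ := exists_mem_degreePart_sub_differential_mem hL hw hb
  have hlx : l • x ∈ F.degreePart (i + 1) j := by
    simpa only [sub_add_cancel] using smul_mem_degreePart hl hx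
  have hcycle : v - l • x ∈ F.cycles L (i + 1) := by
    have h := add_mem hvw (Submodule.smul_mem _ l hwx)
    rwa [smul_sub, sub_add_sub_cancel, ← map_smul, ← map_sub] at h
  have h := hvan _ (sub_mem hv hlx) hcycle
  have hlx' : l • x ∈ F.multiples (L ⊔ Ideal.span {l}) (i + 1) :=
    smul_mem_multiples _ (Ideal.mem_sup_right (Ideal.mem_span_singleton_self l)) x
  simpa only [sub_add_cancel] using
    add_mem (boundaries_mono le_sup_left _ h) (Submodule.mem_sup_right hlx')

theorem mem_boundaries_of_differential_sub_smul_mem (hreg : ∀ x, l * x ∈ L → x ∈ L) {i : ℕ}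
    {v : F.Term (i + 1)} {w : F.Term i} (hvw : F.differential i v - l • w ∈ F.multiples L i)
    (hb : v ∈ F.boundaries (L ⊔ Ideal.span {l}) (i + 1)) : w ∈ F.boundaries L i := by
  obtain ⟨u, hu⟩ := mem_boundaries.1 hb
  obtain ⟨y, hy⟩ := exists_sub_smul_mem_multiples hu
  refine mem_boundaries.2 ⟨y, mem_multiples_of_smul_mem hreg ?_⟩
  have h := sub_mem (differential_mem_multiples hy) hvw
  simp only [map_sub, map_smul, differential_differential, sub_zero] at h
  rwa [sub_sub_sub_cancel_left, ← smul_sub] at h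

theorem HomologyVanishes.sup_span_singleton (hL : L.IsHomogeneous forms) (hl : l ∈ forms 1)
    (hreg : ∀ x, l * x ∈ L → x ∈ L) {i : ℕ} {j : ℤ} (h1 : F.HomologyVanishes L (i + 1) j)
    (h0 : F.HomologyVanishes L i (j - 1)) :
    F.HomologyVanishes (L ⊔ Ideal.span {l}) (i + 1) j := by
  intro v hv hc
  obtain ⟨w, hw, hvw⟩ :=
    exists_mem_degreePart_sub_smul_mem hL hl (differential_mem_degreePart hv) hc
  exact mem_boundaries_sup_of_differential_sub_smul_mem hL hl h1 hv hw hvw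
    (h0 w hw (mem_cycles_of_differential_sub_smul_mem hreg hvw))

theorem homologyVanishes_bot_succ (i : ℕ) (j : ℤ) : F.HomologyVanishes ⊥ (i + 1) j := by
  intro v _ hv
  obtain ⟨u, hu⟩ := (F.exact_succ i v).1 (funext (mem_multiples.1 hv))
  exact Submodule.mem_sup_left ⟨u, hu⟩

theorem HomologyVanishes.zero_mono {M : Ideal (MvPolynomial (Fin s) K)} (hLM : L ≤ M) {j : ℤ}
    (h : F.HomologyVanishes L 0 j) : F.HomologyVanishes M 0 j := fun v hv _ =>
  boundaries_mono hLM 0 (h v hv trivial)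

theorem homologyVanishes_zero {j : ℤ} (hj : forms j ≤ (I ⊔ L).restrictScalars K) :
    F.HomologyVanishes L 0 j := by
  intro v hv _
  refine mem_boundaries_zero.2 fun k => hj ?_
  simpa only [F.shift_zero, Nat.cast_zero, sub_zero] using mem_degreePart.1 hv k

theorem le_idealOfVars (F : MinGradedFreeResolution I) : I ≤ idealOfVars (Fin s) K := by
  intro f hf
  obtain ⟨v, hv⟩ := (F.exact_zero f).1 hf
  rw [← congrFun hv default, Matrix.mulVec, dotProduct]
  exact Ideal.sum_mem _ fun k _ => Ideal.mul_mem_right _ _ (F.minimal 0 default k)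

theorem ne_top (F : MinGradedFreeResolution I) : I ≠ ⊤ := by
  rintro rfl
  have h1 : (1 : MvPolynomial (Fin s) K) ∈ idealOfVars (Fin s) K := F.le_idealOfVars trivial
  simp [mem_idealOfVars_iff] at h1

theorem ne_zero_of_forall_mul_mem (F : MinGradedFreeResolution I) {h : MvPolynomial (Fin s) K}
    (hreg : ∀ x, h * x ∈ I → x ∈ I) : h ≠ 0 := by
  rintro rfl
  exact F.ne_top ((Ideal.eq_top_iff_one I).2 (hreg 1 (by simp)))

theorem homologyVanishes_span_singleton {h : MvPolynomial (Fin s) K} (hh : h ∈ forms 1)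
    (hreg : ∀ x, h * x ∈ I → x ∈ I) {i : ℕ} (hi : 0 < i) (j : ℤ) :
    F.HomologyVanishes (Ideal.span {h}) i j := by
  have hreg0 (x) (hx : h * x ∈ (⊥ : Ideal (MvPolynomial (Fin s) K))) :
      x ∈ (⊥ : Ideal (MvPolynomial (Fin s) K)) :=
    (mul_eq_zero.1 hx).resolve_left (F.ne_zero_of_forall_mul_mem hreg)
  have hbot : (⊥ : Ideal (MvPolynomial (Fin s) K)).IsHomogeneous forms := .bot forms
  rw [← bot_sup_eq (Ideal.span {h})]
  match i, hi with
  | i + 2, _ =>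
    exact .sup_span_singleton hbot hh hreg0 (homologyVanishes_bot_succ _ _)
      (homologyVanishes_bot_succ _ _)
  | 1, _ =>
    intro v hv hc
    obtain ⟨w, hw, hvw⟩ :=
      exists_mem_degreePart_sub_smul_mem hbot hh (differential_mem_degreePart hv) hc
    refine mem_boundaries_sup_of_differential_sub_smul_mem hbot hh
      (homologyVanishes_bot_succ _ _) hv hw hvw (mem_boundaries_zero.2 fun k => ?_)
    have hk : F.differential 0 v k = h * w k := sub_eq_zero.1 (mem_multiples.1 hvw k)
    exact Ideal.mem_sup_left (hreg _ (hk ▸ differential_zero_mem v k))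

end MinGradedFreeResolution

/-! ### Linear regular sequences -/

/-- The linear forms in the list, taken from the last one to the first one, form a regular sequence
on `S/Q`. -/
def IsLinearRegular (Q : Ideal (MvPolynomial (Fin s) K)) : List (MvPolynomial (Fin s) K) → Prop
  | [] => True
  | l :: ls => IsLinearRegular Q ls ∧ l ∈ forms 1 ∧
      ∀ x, l * x ∈ Q ⊔ Ideal.ofList ls → x ∈ Q ⊔ Ideal.ofList ls

theorem sup_ofList_cons (Q : Ideal (MvPolynomial (Fin s) K)) (l : MvPolynomial (Fin s) K)
    (ls : List (MvPolynomial (Fin s) K)) :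
    Q ⊔ Ideal.ofList (l :: ls) = Q ⊔ Ideal.ofList ls ⊔ Ideal.span {l} := by
  rw [Ideal.ofList_cons, sup_comm (Ideal.span {l}), sup_assoc]

theorem IsLinearRegular.isHomogeneous_sup_ofList {Q : Ideal (MvPolynomial (Fin s) K)}
    (hQ : Q.IsHomogeneous forms) {ls : List (MvPolynomial (Fin s) K)}
    (hls : IsLinearRegular Q ls) : (Q ⊔ Ideal.ofList ls).IsHomogeneous forms := by
  induction ls with
  | nil => simpa using hQ
  | cons l ls ih =>
    rw [sup_ofList_cons]
    exact (ih hls.1).sup (isHomogeneous_span_singleton hls.2.1)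

namespace MinGradedFreeResolution

variable {I Q : Ideal (MvPolynomial (Fin s) K)} {F : MinGradedFreeResolution I}
  {ls : List (MvPolynomial (Fin s) K)}

theorem homologyVanishes_sup_ofList (hQ : Q.IsHomogeneous forms) (hls : IsLinearRegular Q ls)
    {i : ℕ} {j : ℤ}
    (hvan : ∀ i' k : ℕ, i' + k = i → k ≤ ls.length → F.HomologyVanishes Q i' (j - k)) :
    F.HomologyVanishes (Q ⊔ Ideal.ofList ls) i j := by
  induction ls generalizing i j with
  | nil => simpa using hvan i 0 rfl le_rfl
  | cons l ls ih =>
    obtain ⟨hls, hl, hreg⟩ := hls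
    have h1 : F.HomologyVanishes (Q ⊔ Ideal.ofList ls) i j :=
      ih hls fun i' k hik hk => hvan i' k hik (Nat.le_succ_of_le hk)
    rw [sup_ofList_cons]
    match i with
    | 0 => exact h1.zero_mono le_sup_left
    | i + 1 =>
      refine h1.sup_span_singleton (hls.isHomogeneous_sup_ofList hQ) hl hreg (ih hls ?_)
      intro i' k hik hk
      have h := hvan i' (k + 1) (by omega) (Nat.succ_le_succ hk)
      rwa [Nat.cast_add_one, add_comm (k : ℤ), ← sub_sub] at h

/-- `F.IsZigzag Q [lₙ, …, l₁] e f v` says that `f` is a form of degree `e` and that there are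
homogeneous `vₖ ∈ Fₖ` with `v₀ = f`, `vₙ = v` and `d vₖ₊₁ ≡ lₖ₊₁ vₖ` modulo `(Q, l₁, …, lₖ)`. It is
the relation between `S/(I + Q)` and the homology of `F / (Q, l₁, …, lₙ) F` given by the iterated
connecting maps of the sequences `0 → F / L F → F / L F → F / (L, l) F → 0`. -/
def IsZigzag (F : MinGradedFreeResolution I) (Q : Ideal (MvPolynomial (Fin s) K)) :
    (ls : List (MvPolynomial (Fin s) K)) → ℤ → MvPolynomial (Fin s) K → F.Term ls.length → Prop
  | [], e, f, v => f ∈ forms e ∧ v = fun _ => f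
  | l :: ls, e, f, v => v ∈ F.degreePart (ls.length + 1) (e + ls.length + 1) ∧
      ∃ w, IsZigzag F Q ls e f w ∧
        F.differential ls.length v - l • w ∈ F.multiples (Q ⊔ Ideal.ofList ls) ls.length

namespace IsZigzag

variable {e : ℤ} {f : MvPolynomial (Fin s) K}

theorem mem_degreePart {v : F.Term ls.length} (h : F.IsZigzag Q ls e f v) :
    v ∈ F.degreePart ls.length (e + ls.length) := by
  match ls, v, h with
  | [], _, ⟨hf, rfl⟩ =>
    exact MinGradedFreeResolution.mem_degreePart.2 fun k => by simpa [F.shift_zero] using hf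
  | l :: ls, v, h => simpa only [List.length_cons, Nat.cast_add_one, add_assoc] using h.1

theorem sub {f' : MvPolynomial (Fin s) K} {v v' : F.Term ls.length} (h : F.IsZigzag Q ls e f v)
    (h' : F.IsZigzag Q ls e f' v') : F.IsZigzag Q ls e (f - f') (v - v') := by
  induction ls with
  | nil =>
    obtain ⟨⟨hf, rfl⟩, hf', rfl⟩ := And.intro h h'
    exact ⟨sub_mem hf hf', rfl⟩
  | cons l ls ih =>
    obtain ⟨⟨hv, w, hw, hvw⟩, hv', w', hw', hvw'⟩ := And.intro h h'
    refine ⟨sub_mem hv hv', w - w', ih hw hw', ?_⟩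
    rw [map_sub, smul_sub, sub_sub_sub_comm]
    exact sub_mem hvw hvw'

theorem mul {c : ℤ} {a : MvPolynomial (Fin s) K} (ha : a ∈ forms c) {v : F.Term ls.length}
    (h : F.IsZigzag Q ls e f v) : F.IsZigzag Q ls (e + c) (a * f) (a • v) := by
  induction ls with
  | nil =>
    obtain ⟨hf, rfl⟩ := h
    exact ⟨add_comm e c ▸ SetLike.GradedMul.mul_mem ha hf, rfl⟩
  | cons l ls ih =>
    obtain ⟨hv, w, hw, hvw⟩ := h
    refine ⟨?_, a • w, ih hw, ?_⟩
    · simpa only [add_right_comm _ c] using smul_mem_degreePart ha hv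
    · rw [map_smul, smul_comm, ← smul_sub]
      exact Submodule.smul_mem _ a hvw

theorem mem_boundaries (hQ : Q.IsHomogeneous forms) (hls : IsLinearRegular Q ls)
    (hvan : ∀ (i : ℕ) (j : ℤ), 0 < i → F.HomologyVanishes Q i j) {v : F.Term ls.length}
    (h : F.IsZigzag Q ls e f v) (hf : f ∈ I ⊔ Q) :
    v ∈ F.boundaries (Q ⊔ Ideal.ofList ls) ls.length := by
  induction ls with
  | nil =>
    obtain ⟨-, rfl⟩ := h
    rw [Ideal.ofList_nil, sup_bot_eq]
    exact mem_boundaries_zero.2 fun _ => hf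
  | cons l ls ih =>
    obtain ⟨hv, w, hw, hvw⟩ := h
    obtain ⟨hls, hl, -⟩ := hls
    have hvan' : F.HomologyVanishes (Q ⊔ Ideal.ofList ls) (ls.length + 1) (e + ls.length + 1) :=
      homologyVanishes_sup_ofList hQ hls fun i k hik hk => hvan i _ (by omega)
    rw [sup_ofList_cons]
    exact mem_boundaries_sup_of_differential_sub_smul_mem (hls.isHomogeneous_sup_ofList hQ) hl
      hvan' hv (by rw [add_sub_cancel_right]; exact hw.mem_degreePart) hvw (ih hls hw)

theorem mem_of_mem_boundaries (hls : IsLinearRegular Q ls) {v : F.Term ls.length}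
    (h : F.IsZigzag Q ls e f v) (hb : v ∈ F.boundaries (Q ⊔ Ideal.ofList ls) ls.length) :
    f ∈ I ⊔ Q := by
  induction ls with
  | nil =>
    obtain ⟨-, rfl⟩ := h
    rw [Ideal.ofList_nil, sup_bot_eq] at hb
    exact mem_boundaries_zero.1 hb default
  | cons l ls ih =>
    obtain ⟨-, w, hw, hvw⟩ := h
    obtain ⟨hls, -, hreg⟩ := hls
    rw [sup_ofList_cons] at hb
    exact ih hls hw (mem_boundaries_of_differential_sub_smul_mem hreg hvw hb)

theorem exists_of_forall_mul_mem (hQ : Q.IsHomogeneous forms) (hls : IsLinearRegular Q ls)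
    (hvan : ∀ (i : ℕ) (j : ℤ), 0 < i → F.HomologyVanishes Q i j) (hf : f ∈ forms e)
    (hmul : ∀ l ∈ ls, l * f ∈ I ⊔ Q) : ∃ v, F.IsZigzag Q ls e f v := by
  induction ls with
  | nil => exact ⟨_, hf, rfl⟩
  | cons l ls ih =>
    obtain ⟨hls, hl, -⟩ := hls
    obtain ⟨hlf, hmul⟩ := List.forall_mem_cons.1 hmul
    obtain ⟨w, hw⟩ := ih hls hmul
    have hlw := hw.mul hl
    obtain ⟨u, hu, hwu⟩ := exists_mem_degreePart_sub_differential_mem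
      (hls.isHomogeneous_sup_ofList hQ) hlw.mem_degreePart (hlw.mem_boundaries hQ hls hvan hlf)
    refine ⟨u, by rwa [add_right_comm], w, hw, ?_⟩
    rw [← neg_sub]
    exact neg_mem hwu

end IsZigzag

/-! ### Minimality -/

theorem boundaries_idealOfVars (F : MinGradedFreeResolution I) (i : ℕ) :
    F.boundaries (idealOfVars (Fin s) K) i = F.multiples (idealOfVars (Fin s) K) i := by
  refine sup_eq_right.2 ?_
  rintro _ ⟨u, rfl⟩
  refine mem_multiples.2 fun k => ?_
  rw [differential_apply]
  exact Ideal.sum_mem _ fun k' _ => Ideal.mul_mem_right _ _ (F.minimal i k k')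

theorem cycles_idealOfVars (F : MinGradedFreeResolution I) (i : ℕ) :
    F.cycles (idealOfVars (Fin s) K) i = ⊤ := by
  match i with
  | 0 => rfl
  | i + 1 =>
    refine top_le_iff.1 fun v _ => ?_
    rw [cycles, Submodule.mem_comap, ← boundaries_idealOfVars]
    exact Submodule.mem_sup_left ⟨v, rfl⟩

theorem HomologyVanishes.shift_ne {i : ℕ} {j : ℤ}
    (hvan : F.HomologyVanishes (idealOfVars (Fin s) K) i j) (k : Fin (F.rank i)) :
    (F.shift i k : ℤ) ≠ j := by
  rintro rfl
  have hmem : Pi.single k 1 ∈ F.degreePart i (F.shift i k) := mem_degreePart.2 fun k' => by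
    obtain rfl | hk := eq_or_ne k' k
    · rw [Pi.single_eq_same, sub_self]
      exact C_mem_forms_zero 1
    · rw [Pi.single_eq_of_ne hk]
      exact zero_mem _
  have hb := hvan _ hmem (cycles_idealOfVars F i ▸ Submodule.mem_top)
  rw [boundaries_idealOfVars] at hb
  simpa [mem_idealOfVars_iff] using mem_multiples.1 hb k

theorem rank_eq_zero_of_length_lt (hQ : Q.IsHomogeneous forms) (hls : IsLinearRegular Q ls)
    (hvars : Q ⊔ Ideal.ofList ls = idealOfVars (Fin s) K)
    (hvan : ∀ (i : ℕ) (j : ℤ), 0 < i → F.HomologyVanishes Q i j) {i : ℕ} (hi : ls.length < i) :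
    F.rank i = 0 := by
  by_contra hrank
  have k : Fin (F.rank i) := ⟨0, Nat.pos_of_ne_zero hrank⟩
  have h : F.HomologyVanishes (Q ⊔ Ideal.ofList ls) i (F.shift i k) :=
    homologyVanishes_sup_ofList hQ hls fun i' n hin hn => hvan i' _ (by omega)
  exact (hvars ▸ h).shift_ne k rfl

theorem shift_le (hQ : Q.IsHomogeneous forms) (hls : IsLinearRegular Q ls)
    (hvars : Q ⊔ Ideal.ofList ls = idealOfVars (Fin s) K)
    (hvan : ∀ (i : ℕ) (j : ℤ), 0 < i → F.HomologyVanishes Q i j) {D : ℕ}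
    (hD : ∀ j : ℤ, D < j → F.HomologyVanishes Q 0 j) (i : ℕ) (k : Fin (F.rank i)) :
    F.shift i k ≤ i + D := by
  by_contra! hlt
  have h : F.HomologyVanishes (Q ⊔ Ideal.ofList ls) i (F.shift i k) := by
    refine homologyVanishes_sup_ofList hQ hls fun i' n hin _ => ?_
    obtain rfl | hi' := Nat.eq_zero_or_pos i'
    · exact hD _ (by omega)
    · exact hvan i' _ hi'
  exact (hvars ▸ h).shift_ne k rfl

theorem IsZigzag.exists_notMem_idealOfVars (hls : IsLinearRegular Q ls)
    (hvars : Q ⊔ Ideal.ofList ls = idealOfVars (Fin s) K) {e : ℤ} {f : MvPolynomial (Fin s) K}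
    {v : F.Term ls.length} (h : F.IsZigzag Q ls e f v) (hf : f ∉ I ⊔ Q) :
    ∃ k, v k ∉ idealOfVars (Fin s) K := by
  by_contra! hv
  refine hf (h.mem_of_mem_boundaries hls ?_)
  rw [hvars, boundaries_idealOfVars]
  exact mem_multiples.2 hv

theorem exists_shift_eq (hQ : Q.IsHomogeneous forms) (hls : IsLinearRegular Q ls)
    (hvars : Q ⊔ Ideal.ofList ls = idealOfVars (Fin s) K)
    (hvan : ∀ (i : ℕ) (j : ℤ), 0 < i → F.HomologyVanishes Q i j) {e : ℤ}
    {f : MvPolynomial (Fin s) K} (hf : f ∈ forms e) (hmul : ∀ l ∈ ls, l * f ∈ I ⊔ Q)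
    (hfJ : f ∉ I ⊔ Q) : ∃ k, (F.shift ls.length k : ℤ) = e + ls.length := by
  obtain ⟨v, hv⟩ := IsZigzag.exists_of_forall_mul_mem hQ hls hvan hf hmul
  obtain ⟨k, hk⟩ := hv.exists_notMem_idealOfVars hls hvars hfJ
  have h0 := eq_zero_of_mem_forms_of_notMem_idealOfVars (mem_degreePart.1 hv.mem_degreePart k) hk
  exact ⟨k, (sub_eq_zero.1 h0).symm⟩

theorem exists_sub_C_mul_mem (hQ : Q.IsHomogeneous forms) (hls : IsLinearRegular Q ls)
    (hvars : Q ⊔ Ideal.ofList ls = idealOfVars (Fin s) K)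
    (hvan : ∀ (i : ℕ) (j : ℤ), 0 < i → F.HomologyVanishes Q i j)
    (hrank : F.rank ls.length = 1) {e e' : ℤ} {f g : MvPolynomial (Fin s) K} (hf : f ∈ forms e)
    (hg : g ∈ forms e') (hlf : ∀ l ∈ ls, l * f ∈ I ⊔ Q) (hlg : ∀ l ∈ ls, l * g ∈ I ⊔ Q)
    (hgJ : g ∉ I ⊔ Q) : ∃ c : K, f - C c * g ∈ I ⊔ Q := by
  by_cases hfJ : f ∈ I ⊔ Q
  · exact ⟨0, by simpa using hfJ⟩
  have := (finCongr hrank).subsingleton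
  obtain rfl : e = e' := by
    obtain ⟨k, hk⟩ := exists_shift_eq hQ hls hvars hvan hf hlf hfJ
    obtain ⟨k', hk'⟩ := exists_shift_eq hQ hls hvars hvan hg hlg hgJ
    rw [Subsingleton.elim k k', hk'] at hk
    exact (add_right_cancel hk).symm
  obtain ⟨v, hv⟩ := IsZigzag.exists_of_forall_mul_mem hQ hls hvan hf hlf
  obtain ⟨w, hw⟩ := IsZigzag.exists_of_forall_mul_mem hQ hls hvan hg hlg
  obtain ⟨k, hk⟩ := hw.exists_notMem_idealOfVars hls hvars hgJ
  rw [mem_idealOfVars_iff] at hk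
  refine ⟨coeff 0 (v k) / coeff 0 (w k), ?_⟩
  have hcw := hw.mul (C_mem_forms_zero (coeff 0 (v k) / coeff 0 (w k)))
  rw [add_zero] at hcw
  by_contra hmem
  obtain ⟨k', hk'⟩ := (hv.sub hcw).exists_notMem_idealOfVars hls hvars hmem
  rw [Subsingleton.elim k' k, mem_idealOfVars_iff] at hk'
  exact hk' (by simp [hk])

end MinGradedFreeResolution

/-! ### Linear forms and variables -/

section Variables

variable {σ R : Type*} [CommRing R]

theorem notMem_span_X_image {A : Set σ} {i : σ} (hi : i ∉ A)
    {p : MvPolynomial σ R} (hp : coeff (Finsupp.single i 1) p ≠ 0) :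
    p ∉ Ideal.span (X '' A) := by
  intro hmem
  obtain ⟨k, hk, hik⟩ := mem_ideal_span_X_image.1 hmem _ (mem_support_iff.2 hp)
  obtain rfl : k = i := by_contra fun hki => hik (Finsupp.single_eq_of_ne hki)
  exact hi hk

theorem ofList_map_X (L : List σ) :
    Ideal.ofList (L.map (X : σ → MvPolynomial σ R)) = Ideal.span (X '' {k | k ∈ L}) := by
  simp only [Ideal.ofList, List.mem_map, Set.image, Set.mem_ofPred_eq]

variable [IsDomain R]

theorem isPrime_span_X_image (A : Set σ) :
    (Ideal.span (X '' A : Set (MvPolynomial σ R))).IsPrime := by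
  classical
  let φ : MvPolynomial σ R →ₐ[R] MvPolynomial σ R :=
    aeval fun k => if k ∈ A then 0 else X k
  suffices hker : Ideal.span (X '' A) = RingHom.ker φ from hker ▸ RingHom.ker_isPrime φ
  refine le_antisymm (Ideal.span_le.2 ?_) fun p hp => ?_
  · rintro _ ⟨k, hk, rfl⟩
    simp [φ, hk]
  · have hφ : (Ideal.Quotient.mkₐ R (Ideal.span (X '' A))).comp φ = Ideal.Quotient.mkₐ R _ := by
      refine algHom_ext fun k => ?_
      by_cases hk : k ∈ A
      · have hXk : (X k : MvPolynomial σ R) ∈ Ideal.span (X '' A) :=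
          Ideal.subset_span ⟨k, hk, rfl⟩
        simpa [φ, hk] using (Ideal.Quotient.eq_zero_iff_mem.2 hXk).symm
      · simp [φ, hk]
    have hpφ := DFunLike.congr_fun hφ p
    rw [AlgHom.comp_apply, RingHom.mem_ker.1 hp, map_zero] at hpφ
    exact Ideal.Quotient.eq_zero_iff_mem.1 hpφ.symm

theorem mem_span_singleton_sup_span_X_image_of_X_mul_mem {A : Set σ} {j : σ}
    (hj : j ∉ A) {h : MvPolynomial σ R} (hh : h ∉ Ideal.span (X '' insert j A))
    {x : MvPolynomial σ R} (hx : X j * x ∈ Ideal.span {h} ⊔ Ideal.span (X '' A)) :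
    x ∈ Ideal.span {h} ⊔ Ideal.span (X '' A) := by
  rw [Ideal.mem_span_singleton_sup] at hx
  obtain ⟨y, z, hz, hyz⟩ := hx
  rw [Set.image_insert_eq, Ideal.span_insert] at hh
  have hprime := isPrime_span_X_image (R := R) (insert j A)
  rw [Set.image_insert_eq, Ideal.span_insert] at hprime
  have hy : y ∈ Ideal.span {X j} ⊔ Ideal.span (X '' A) := by
    refine (hprime.mem_or_mem ?_).resolve_right hh
    rw [eq_sub_of_add_eq hyz, mul_comm]
    exact sub_mem (Ideal.mem_sup_left (Ideal.mul_mem_left _ _ (Ideal.mem_span_singleton_self _)))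
      (Ideal.mem_sup_right hz)
  rw [Ideal.mem_span_singleton_sup] at hy
  obtain ⟨w, z', hz', rfl⟩ := hy
  have hxw : X j * (x - w * h) ∈ Ideal.span (X '' A) := by
    have hmem := add_mem hz (Ideal.mul_mem_right h _ hz')
    convert hmem using 1
    linear_combination -hyz
  have hXj : (X j : MvPolynomial σ R) ∉ Ideal.span (X '' A) :=
    notMem_span_X_image hj (by simp)
  rw [← add_sub_cancel (w * h) x]
  exact Submodule.add_mem_sup (Ideal.mul_mem_left _ _ (Ideal.mem_span_singleton_self h))
    (((isPrime_span_X_image A).mem_or_mem hxw).resolve_left hXj)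

end Variables

theorem isLinearRegular_map_X {h : MvPolynomial (Fin s) K} {i : Fin s}
    (hi : coeff (Finsupp.single i 1) h ≠ 0) {L : List (Fin s)} (hL : L.Nodup) (hiL : i ∉ L) :
    IsLinearRegular (Ideal.span {h}) (L.map X) := by
  induction L with
  | nil => trivial
  | cons j L ih =>
    refine ⟨ih hL.of_cons (List.not_mem_of_not_mem_cons hiL),
      X_mem_forms_one j, fun x hx => ?_⟩
    rw [ofList_map_X] at hx ⊢
    refine mem_span_singleton_sup_span_X_image_of_X_mul_mem (A := {k | k ∈ L}) hL.notMem
      (notMem_span_X_image (i := i) ?_ hi) hx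
    simpa using hiL

theorem span_singleton_sup_span_X_image_compl {h : MvPolynomial (Fin s) K} (hh : h ∈ forms 1)
    {i : Fin s} (hi : coeff (Finsupp.single i 1) h ≠ 0) :
    Ideal.span {h} ⊔ Ideal.span (X '' {i}ᶜ) = idealOfVars (Fin s) K := by
  have hsub : h - C (coeff (Finsupp.single i 1) h) * X i ∈ Ideal.span (X '' {i}ᶜ) := by
    refine mem_ideal_span_X_image.2 fun a ha => ?_
    rw [mem_support_iff] at ha
    have hX := mem_forms_natCast.2 ((isHomogeneous_X K i).C_mul (coeff (Finsupp.single i 1) h))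
    have hdeg := mem_forms_iff.1 (sub_mem hh hX) a ha
    obtain ⟨k, rfl⟩ := Finsupp.range_single_one.ge (show a.degree = 1 by exact_mod_cast hdeg)
    refine ⟨k, ?_, by simp⟩
    rintro rfl
    simp at ha
  refine le_antisymm (sup_le ?_ (Ideal.span_mono (Set.image_subset_range _ _))) (Ideal.span_le.2 ?_)
  · rw [Ideal.span_singleton_le_iff_mem, mem_idealOfVars_iff]
    by_contra h0
    simpa using mem_forms_iff.1 hh 0 h0
  · rintro _ ⟨k, rfl⟩
    obtain rfl | hk := eq_or_ne k i
    · have hcX := sub_mem (Ideal.mem_sup_left (Ideal.mem_span_singleton_self h))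
        (Ideal.mem_sup_right hsub)
      rw [sub_sub_cancel] at hcX
      simpa [← mul_assoc, ← C_mul, hi] using
        Ideal.mul_mem_left _ (C (coeff (Finsupp.single k 1) h)⁻¹) hcX
    · exact Ideal.mem_sup_right (Ideal.subset_span ⟨k, hk, rfl⟩)

theorem exists_isLinearRegular_sup_ofList_eq_idealOfVars {h : MvPolynomial (Fin s) K}
    (hh : h ∈ forms 1) (h0 : h ≠ 0) : ∃ ls, IsLinearRegular (Ideal.span {h}) ls ∧
      Ideal.span {h} ⊔ Ideal.ofList ls = idealOfVars (Fin s) K := by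
  obtain ⟨a, ha⟩ := ne_zero_iff.1 h0
  obtain ⟨i, rfl⟩ := Finsupp.range_single_one.ge
    (show a.degree = 1 by exact_mod_cast mem_forms_iff.1 hh a ha)
  refine ⟨(Finset.univ.erase i).toList.map X,
    isLinearRegular_map_X ha (Finset.nodup_toList _) (by simp), ?_⟩
  rw [ofList_map_X, ← span_singleton_sup_span_X_image_compl hh ha]
  congr
  ext k
  simp

/-! ### Betti numbers -/

section Betti

variable {I : Ideal (MvPolynomial (Fin s) K)} [hne : Nonempty (MinGradedFreeResolution I)]

theorem gradedBetti_eq_card (i j : ℕ) :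
    gradedBetti I i j = (Finset.univ.filter fun k => hne.some.shift i k = j).card := by
  simp only [gradedBetti, dif_pos hne]

theorem gradedBetti_ne_zero_iff {i j : ℕ} :
    gradedBetti I i j ≠ 0 ↔ ∃ k, hne.some.shift i k = j := by
  simp [gradedBetti_eq_card]

theorem projDim_eq {n : ℕ} (hn : hne.some.rank n ≠ 0)
    (h : ∀ i, n < i → hne.some.rank i = 0) : projDim I = n := by
  refine IsGreatest.csSup_eq
    ⟨⟨_, gradedBetti_ne_zero_iff.2 ⟨⟨0, Nat.pos_of_ne_zero hn⟩, rfl⟩⟩, ?_⟩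
  rintro i ⟨j, hj⟩
  obtain ⟨k, -⟩ := gradedBetti_ne_zero_iff.1 hj
  exact not_lt.1 fun hi => k.pos.ne' (h i hi)

theorem regularity_eq {n d : ℕ} {k : Fin (hne.some.rank n)} (hk : hne.some.shift n k = n + d)
    (h : ∀ i l, hne.some.shift i l ≤ i + d) : regularity I = d := by
  refine IsGreatest.csSup_eq ⟨⟨n, n + d, gradedBetti_ne_zero_iff.2 ⟨k, hk⟩, rfl⟩, ?_⟩
  rintro e ⟨i, j, hij, rfl⟩
  obtain ⟨l, hl⟩ := gradedBetti_ne_zero_iff.1 hij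
  exact Nat.le_of_add_le_add_left (hl ▸ h i l)

theorem IsGorenstein.rank_projDim (hG : IsGorenstein I) : hne.some.rank (projDim I) = 1 := by
  obtain ⟨⟨j, hj, huniq⟩, hone⟩ := hG
  have hcard := hone j hj
  rwa [gradedBetti_eq_card, Finset.filter_true_of_mem, Finset.card_univ, Fintype.card_fin] at hcard
  exact fun k _ => huniq _ (gradedBetti_ne_zero_iff.2 ⟨k, rfl⟩)

end Betti

theorem IsGorenstein.nonempty_minGradedFreeResolution {I : Ideal (MvPolynomial (Fin s) K)}
    (hG : IsGorenstein I) : Nonempty (MinGradedFreeResolution I) := by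
  by_contra h
  obtain ⟨j, hj, -⟩ := hG.1
  exact hj (dif_neg h)

/-! ### The socle -/

section Socle

variable {J : Ideal (MvPolynomial (Fin s) K)} {d : ℕ}

theorem mem_colon_idealOfVars_iff {p : MvPolynomial (Fin s) K} :
    p ∈ Submodule.colon J (idealOfVars (Fin s) K : Set (MvPolynomial (Fin s) K)) ↔
      ∀ i, X i * p ∈ J := by
  simp [idealOfVars, Submodule.mem_colon, mul_comm]

theorem mk_mem_socle_iff {p : MvPolynomial (Fin s) K} :
    Ideal.Quotient.mk J p ∈ socle J ↔ ∀ i, X i * p ∈ J := by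
  rw [socle, Ideal.mem_quotient_iff_mem Ideal.le_colon, mem_colon_idealOfVars_iff]

theorem mul_mem_of_forall_X_mul_mem {p l : MvPolynomial (Fin s) K} (hp : ∀ i, X i * p ∈ J)
    (hl : l ∈ idealOfVars (Fin s) K) : l * p ∈ J := by
  rw [mul_comm]
  exact Submodule.mem_colon.1 (mem_colon_idealOfVars_iff.2 hp) l hl

theorem sub_C_mul_mem_iff {f g : MvPolynomial (Fin s) K} {c : K} :
    f - C c * g ∈ J ↔ c • Ideal.Quotient.mk J g = Ideal.Quotient.mk J f := by
  rw [← Ideal.Quotient.eq, eq_comm, ← smul_eq_C_mul]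
  rfl

theorem socle_eq_span_of_forall_exists_sub_mem (hJ : J.IsHomogeneous forms)
    {g : MvPolynomial (Fin s) K} (hg : ∀ i, X i * g ∈ J)
    (h : ∀ e : ℤ, ∀ f ∈ forms e, (∀ i, X i * f ∈ J) → ∃ c : K, f - C c * g ∈ J) :
    (socle J).restrictScalars K = Submodule.span K {Ideal.Quotient.mk J g} := by
  classical
  refine le_antisymm (fun x hx => ?_)
    ((Submodule.span_singleton_le_iff_mem _ _).2 (mk_mem_socle_iff.2 hg))
  obtain ⟨p, rfl⟩ := Ideal.Quotient.mk_surjective x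
  have hp : ∀ i, X i * p ∈ J := mk_mem_socle_iff.1 hx
  rw [← DirectSum.sum_support_decompose forms p, map_sum]
  refine sum_mem fun e _ => ?_
  obtain ⟨c, hc⟩ := h e _ (proj_forms_mem e p) fun i => by
    have hproj : GradedAlgebra.proj forms (e + 1) (X i * p) ∈ J := hJ (e + 1) (hp i)
    rwa [proj_forms_mul (X_mem_forms_one i), add_sub_cancel_right] at hproj
  exact Submodule.mem_span_singleton.2 ⟨c, sub_C_mul_mem_iff.1 hc⟩

/-- The graded ring `S/J` vanishes in degrees greater than `d` and its socle is one-dimensional and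
concentrated in degree `d`: it is an Artinian Gorenstein ring with socle degree `d`. -/
structure IsArtinianGorenstein (J : Ideal (MvPolynomial (Fin s) K)) (d : ℕ) : Prop where
  isHomogeneous : J.IsHomogeneous forms
  forms_le : ∀ j : ℤ, d < j → forms j ≤ J.restrictScalars K
  exists_socle_eq_span : ∃ g ∈ forms (d : ℤ), g ∉ J ∧
    (socle J).restrictScalars K = Submodule.span K {Ideal.Quotient.mk J g}

namespace IsArtinianGorenstein

variable {f g : MvPolynomial (Fin s) K}

theorem X_mul_mem (hJ : IsArtinianGorenstein J d) (hg : g ∈ forms (d : ℤ)) (i : Fin s) :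
    X i * g ∈ J :=
  hJ.forms_le (1 + d) (by omega) (SetLike.GradedMul.mul_mem (X_mem_forms_one i) hg)

theorem socle_eq_span (hJ : IsArtinianGorenstein J d) (hg : g ∈ forms (d : ℤ)) (hgJ : g ∉ J) :
    (socle J).restrictScalars K = Submodule.span K {Ideal.Quotient.mk J g} := by
  obtain ⟨g₀, -, -, hsoc⟩ := hJ.exists_socle_eq_span
  have hmem : Ideal.Quotient.mk J g ∈ (socle J).restrictScalars K :=
    mk_mem_socle_iff.2 (hJ.X_mul_mem hg)
  rw [hsoc] at hmem ⊢
  obtain ⟨c, hc⟩ := Submodule.mem_span_singleton.1 hmem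
  have hc0 : c ≠ 0 := by
    rintro rfl
    exact hgJ (Ideal.Quotient.eq_zero_iff_mem.1 (by rw [← hc, zero_smul]))
  rw [← hc, Submodule.span_singleton_smul_eq (IsUnit.mk0 c hc0)]

theorem exists_sub_C_mul_mem (hJ : IsArtinianGorenstein J d) (hg : g ∈ forms (d : ℤ))
    (hgJ : g ∉ J) (hf : ∀ i, X i * f ∈ J) : ∃ c : K, f - C c * g ∈ J := by
  have hmem : Ideal.Quotient.mk J f ∈ (socle J).restrictScalars K := mk_mem_socle_iff.2 hf
  rw [hJ.socle_eq_span hg hgJ] at hmem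
  obtain ⟨c, hc⟩ := Submodule.mem_span_singleton.1 hmem
  exact ⟨c, sub_C_mul_mem_iff.2 hc⟩

theorem eq_of_mem_forms (hJ : IsArtinianGorenstein J d) {e : ℤ} (hf : f ∈ forms e)
    (hfJ : f ∉ J) (hfsoc : ∀ i, X i * f ∈ J) : e = d := by
  obtain ⟨g, hg, hgJ, -⟩ := hJ.exists_socle_eq_span
  obtain ⟨c, hc⟩ := hJ.exists_sub_C_mul_mem hg hgJ hfsoc
  by_contra hne
  have hcg : C c * g ∈ forms (d : ℤ) :=
    (mem_forms_natCast.1 hg).C_mul c |> mem_forms_natCast.2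
  have hproj : GradedAlgebra.proj forms e (f - C c * g) ∈ J := hJ.isHomogeneous e hc
  rw [map_sub, proj_forms_of_mem hf, proj_forms_eq_zero hcg (Ne.symm hne), sub_zero] at hproj
  exact hfJ hproj

end IsArtinianGorenstein

end Socle

/-! ### Linear sections of Gorenstein ideals -/

theorem IsGorenstein.isArtinianGorenstein {I : Ideal (MvPolynomial (Fin s) K)}
    (hG : IsGorenstein I) (hI : I.IsHomogeneous forms) {h : MvPolynomial (Fin s) K}
    (hh : h ∈ forms 1) (hreg : ∀ x, h * x ∈ I → x ∈ I) {d : ℕ}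
    (hd : ∀ j : ℤ, d < j → forms j ≤ (I ⊔ Ideal.span {h}).restrictScalars K)
    {g : MvPolynomial (Fin s) K} (hg : g ∈ forms (d : ℤ)) (hgJ : g ∉ I ⊔ Ideal.span {h}) :
    regularity I = d ∧ IsArtinianGorenstein (I ⊔ Ideal.span {h}) d := by
  have hne := hG.nonempty_minGradedFreeResolution
  obtain ⟨ls, hls, hvars⟩ := exists_isLinearRegular_sup_ofList_eq_idealOfVars hh
    (hne.some.ne_zero_of_forall_mul_mem hreg)
  have hmul {f} (hf : ∀ i, X i * f ∈ I ⊔ Ideal.span {h}) (l) (hl : l ∈ ls) :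
      l * f ∈ I ⊔ Ideal.span {h} :=
    mul_mem_of_forall_X_mul_mem hf (hvars ▸ Ideal.mem_sup_right (Ideal.subset_span hl))
  have hQ := isHomogeneous_span_singleton hh
  have hvan (i : ℕ) (j : ℤ) (hi : 0 < i) : hne.some.HomologyVanishes (Ideal.span {h}) i j :=
    MinGradedFreeResolution.homologyVanishes_span_singleton hh hreg hi j
  have hgsoc (i) : X i * g ∈ I ⊔ Ideal.span {h} :=
    hd (1 + d) (by omega) (SetLike.GradedMul.mul_mem (X_mem_forms_one i) hg)
  obtain ⟨k, hk⟩ :=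
    MinGradedFreeResolution.exists_shift_eq hQ hls hvars hvan hg (hmul hgsoc) hgJ
  have hproj : projDim I = ls.length := projDim_eq k.pos.ne' fun i hi =>
    MinGradedFreeResolution.rank_eq_zero_of_length_lt hQ hls hvars hvan hi
  refine ⟨regularity_eq (k := k) (by omega) ?_, hI.sup hQ, hd, g, hg, hgJ, ?_⟩
  · exact MinGradedFreeResolution.shift_le hQ hls hvars hvan fun j hj =>
      MinGradedFreeResolution.homologyVanishes_zero (hd j hj)
  · exact socle_eq_span_of_forall_exists_sub_mem (hI.sup hQ) hgsoc fun e f hf hfsoc =>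
      MinGradedFreeResolution.exists_sub_C_mul_mem hQ hls hvars hvan (hproj ▸ hG.rank_projDim) hf hg
        (hmul hfsoc) (hmul hgsoc) hgJ

/-! ### Standard monomials -/

section StandardMonomials

variable {ord : MonomialOrder (Fin s)} {J : Ideal (MvPolynomial (Fin s) K)}

theorem notMem_footprint_iff {a : Fin s →₀ ℕ} :
    a ∉ footprint ord J ↔ ∃ f ∈ J, f ≠ 0 ∧ ord.degree f ≤ a := by
  have himage : {u | ∃ f ∈ J, f ≠ 0 ∧ u = monomial (ord.degree f) (1 : K)} =
      (fun b => monomial b 1) '' (ord.degree '' {f | f ∈ J ∧ f ≠ 0}) := by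
    ext u
    simp [and_assoc, eq_comm]
  classical
  rw [footprint, Set.mem_ofPred_eq, not_not, initialIdeal, himage, mem_ideal_span_monomial_image,
    support_monomial, if_neg one_ne_zero]
  simp [and_assoc]

theorem degree_notMem_footprint {f : MvPolynomial (Fin s) K} (hf : f ∈ J) (h0 : f ≠ 0) :
    ord.degree f ∉ footprint ord J :=
  notMem_footprint_iff.2 ⟨f, hf, h0, le_rfl⟩

theorem mem_standardSpan_iff {r : MvPolynomial (Fin s) K} :
    r ∈ standardSpan ord J ↔ ∀ a, coeff a r ≠ 0 → a ∈ footprint ord J := by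
  rw [standardSpan, ← restrictSupport_eq_span, mem_restrictSupport_iff]
  simp [Set.subset_def]

theorem monomial_mem_standardSpan {a : Fin s →₀ ℕ} (ha : a ∈ footprint ord J) (c : K) :
    monomial a c ∈ standardSpan ord J := by
  rw [standardSpan, ← restrictSupport_eq_span]
  exact (monomial_mem_restrictSupport K).2 (Or.inl ha)

theorem eq_zero_of_mem_standardSpan {r : MvPolynomial (Fin s) K} (hr : r ∈ standardSpan ord J)
    (hrJ : r ∈ J) : r = 0 := by
  by_contra h0
  exact degree_notMem_footprint hrJ h0
    (mem_standardSpan_iff.1 hr _ (ord.coeff_degree_ne_zero_iff.2 h0))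

theorem monomial_notMem_of_mem_footprint {a : Fin s →₀ ℕ} (ha : a ∈ footprint ord J) :
    monomial a (1 : K) ∉ J := fun hJ =>
  one_ne_zero (monomial_eq_zero.1 (eq_zero_of_mem_standardSpan (monomial_mem_standardSpan ha 1) hJ))

theorem exists_isRemainder (ord : MonomialOrder (Fin s)) (J : Ideal (MvPolynomial (Fin s) K))
    (f : MvPolynomial (Fin s) K) : ∃ r, IsRemainder ord J f r := by
  obtain ⟨g, r, hfr, -, hr⟩ := ord.div_set (B := {b | b ∈ J ∧ b ≠ 0})
    (fun b hb => (ord.leadingCoeff_ne_zero_iff.2 hb.2).isUnit) f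
  refine ⟨r, mem_standardSpan_iff.2 fun a ha => ?_, _, ?_, hfr⟩
  · by_contra hfoot
    obtain ⟨b, hb, h0, hba⟩ := notMem_footprint_iff.1 hfoot
    exact hr a (mem_support_iff.2 ha) b ⟨hb, h0⟩ hba
  · rw [Finsupp.linearCombination_apply]
    exact Ideal.sum_mem _ fun b _ => Ideal.mul_mem_left _ _ b.2.1

theorem IsRemainder.sub_mem {f r : MvPolynomial (Fin s) K} (h : IsRemainder ord J f r) :
    f - r ∈ J := by
  obtain ⟨-, g, hg, rfl⟩ := h
  simpa using hg

theorem isRemainder_iff_eq {f r : MvPolynomial (Fin s) K} (hr : r ∈ standardSpan ord J)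
    (hfr : f - r ∈ J) (r' : MvPolynomial (Fin s) K) : IsRemainder ord J f r' ↔ r' = r := by
  refine ⟨fun h => ?_, ?_⟩
  · rw [← sub_eq_zero]
    refine eq_zero_of_mem_standardSpan (Submodule.sub_mem _ h.1 hr) ?_
    simpa using J.sub_mem hfr h.sub_mem
  · rintro rfl
    exact ⟨hr, _, hfr, (sub_add_cancel _ _).symm⟩

namespace IsArtinianGorenstein

variable {d : ℕ} {a : Fin s →₀ ℕ} {f : MvPolynomial (Fin s) K}

theorem footprintDeg_nonempty (hJ : IsArtinianGorenstein J d) (ord : MonomialOrder (Fin s)) :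
    (footprintDeg ord J d).Nonempty := by
  obtain ⟨g, hg, hgJ, -⟩ := hJ.exists_socle_eq_span
  obtain ⟨r, hr⟩ := exists_isRemainder ord J g
  have hproj : GradedAlgebra.proj forms (d : ℤ) (g - r) ∈ J := hJ.isHomogeneous d hr.sub_mem
  rw [map_sub, proj_forms_of_mem hg] at hproj
  have hr0 : GradedAlgebra.proj forms (d : ℤ) r ≠ 0 := fun h0 =>
    hgJ (by rwa [h0, sub_zero] at hproj)
  obtain ⟨a, ha⟩ := ne_zero_iff.1 hr0
  rw [coeff_proj_forms, ite_ne_right_iff, Nat.cast_inj] at ha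
  exact ⟨a, mem_standardSpan_iff.1 hr.1 a ha.2, ha.1⟩

theorem exists_sub_monomial_mem (hJ : IsArtinianGorenstein J d) (ha : a ∈ footprintDeg ord J d)
    (hf : f ∈ forms (d : ℤ)) : ∃ c : K, f - monomial a c ∈ J := by
  obtain ⟨c, hc⟩ := hJ.exists_sub_C_mul_mem (monomial_mem_forms ha.2 1)
    (monomial_notMem_of_mem_footprint ha.1) (hJ.X_mul_mem hf)
  rw [C_mul_monomial, mul_one] at hc
  exact ⟨c, hc⟩

theorem exists_footprintDeg_eq_singleton (hJ : IsArtinianGorenstein J d)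
    (ord : MonomialOrder (Fin s)) : ∃ a, footprintDeg ord J d = {a} := by
  obtain ⟨a, ha⟩ := hJ.footprintDeg_nonempty ord
  refine ⟨a, Set.eq_singleton_iff_unique_mem.2 ⟨ha, fun b hb => ?_⟩⟩
  obtain ⟨c, hc⟩ := hJ.exists_sub_monomial_mem ha (monomial_mem_forms hb.2 (1 : K))
  have h0 := eq_zero_of_mem_standardSpan (Submodule.sub_mem _ (monomial_mem_standardSpan hb.1 1)
    (monomial_mem_standardSpan ha.1 c)) hc
  exact ((monomial_eq_monomial_iff b a 1 c).1 (sub_eq_zero.1 h0)).elim And.left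
    fun h => absurd h.1 one_ne_zero

theorem exists_isRemainder_iff (hJ : IsArtinianGorenstein J d) (ha : a ∈ footprintDeg ord J d)
    (hf : f ∈ forms (d : ℤ)) (hfJ : f ∉ J) :
    ∃ c : K, c ≠ 0 ∧ ∀ r, IsRemainder ord J f r ↔ r = monomial a c := by
  obtain ⟨c, hc⟩ := hJ.exists_sub_monomial_mem ha hf
  refine ⟨c, ?_, isRemainder_iff_eq (monomial_mem_standardSpan ha.1 c) hc⟩
  rintro rfl
  exact hfJ (by simpa using hc)

end IsArtinianGorenstein

end StandardMonomials

/-! ### Indicator functions -/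

section Indicators

theorem mem_vanishingIdeal_iff {Y : Set (ℙ K (Fin s → K))} {f : MvPolynomial (Fin s) K} :
    f ∈ vanishingIdeal Y ↔
      ∀ n : ℤ, ∀ p ∈ Y, eval p.rep (GradedAlgebra.proj forms n f) = 0 := by
  classical
  refine ⟨fun hf n p hp => ?_, fun hf => ?_⟩
  · rw [vanishingIdeal, Ideal.span] at hf
    induction hf using Submodule.span_induction generalizing n with
    | zero => simp
    | add x y _ _ hx hy => rw [map_add, map_add, hx, hy, add_zero]
    | mem x hx =>
      obtain ⟨⟨d, hd⟩, hx⟩ := hx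
      rw [← mul_one x, proj_forms_mul (mem_forms_natCast.2 hd), map_mul, hx p hp, zero_mul]
    | smul a x _ hx =>
      rw [← DirectSum.sum_support_decompose forms a, Finset.sum_smul, map_sum, map_sum]
      refine Finset.sum_eq_zero fun i _ => ?_
      rw [smul_eq_mul, proj_forms_mul (SetLike.coe_mem _), map_mul, hx, mul_zero]
  · rw [← DirectSum.sum_support_decompose forms f]
    exact Ideal.sum_mem _ fun i _ => Ideal.subset_span
      ⟨exists_isHomogeneous_of_mem_forms (proj_forms_mem i f), hf i⟩

theorem mem_vanishingIdeal_iff_of_mem_forms {Y : Set (ℙ K (Fin s → K))}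
    {f : MvPolynomial (Fin s) K} {n : ℤ} (hf : f ∈ forms n) :
    f ∈ vanishingIdeal Y ↔ ∀ p ∈ Y, eval p.rep f = 0 := by
  refine ⟨fun h p hp => ?_, fun h => Ideal.subset_span ⟨exists_isHomogeneous_of_mem_forms hf, h⟩⟩
  rw [← proj_forms_of_mem hf]
  exact mem_vanishingIdeal_iff.1 h n p hp

theorem isHomogeneous_vanishingIdeal (Y : Set (ℙ K (Fin s → K))) :
    (vanishingIdeal Y).IsHomogeneous forms :=
  Ideal.homogeneous_span _ _ fun _ ⟨⟨d, hd⟩, _⟩ => ⟨d, mem_forms_natCast.2 hd⟩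

theorem vanishingIdeal_empty : vanishingIdeal (∅ : Set (ℙ K (Fin s → K))) = ⊤ :=
  (Ideal.eq_top_iff_one _).2 <|
    (mem_vanishingIdeal_iff_of_mem_forms (C_mem_forms_zero 1)).2 (by simp)

variable {m : ℕ} {P : Fin m → ℙ K (Fin s → K)} {i : Fin m} {g h : MvPolynomial (Fin s) K}

theorem IsIndicator.ne_zero (hg : IsIndicator P i g) : g ≠ 0 := by
  rintro rfl
  exact hg.2.1 (map_zero _)

theorem IsIndicator.mem_forms (hg : IsIndicator P i g) : g ∈ forms (g.totalDegree : ℤ) := by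
  obtain ⟨d, hd⟩ := hg.1
  rwa [hd.totalDegree hg.ne_zero, mem_forms_natCast]

theorem IsIndicator.colon_eq (hg : IsIndicator P i g) :
    Submodule.colon (vanishingIdeal (Set.range P)) {g} = vanishingIdeal {P i} := by
  ext f
  rw [Submodule.mem_colon_singleton, smul_eq_mul, mul_comm, mem_vanishingIdeal_iff,
    mem_vanishingIdeal_iff]
  constructor
  · rintro hf n p rfl
    have h0 := hf (n + g.totalDegree) (P i) ⟨i, rfl⟩
    rw [proj_forms_mul hg.mem_forms, map_mul, add_sub_cancel_right] at h0
    exact (mul_eq_zero.1 h0).resolve_left hg.2.1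
  · rintro hf n _ ⟨j, rfl⟩
    rw [proj_forms_mul hg.mem_forms, map_mul]
    obtain rfl | hji := eq_or_ne j i
    · rw [hf _ _ rfl, mul_zero]
    · rw [hg.2.2 j hji, zero_mul]

theorem IsIndicator.vNumber_le (hg : IsIndicator P i g) {n : ℤ} (hn : g ∈ forms n) :
    vNumber (vanishingIdeal (Set.range P)) (vanishingIdeal {P i}) ≤ n := by
  rw [DirectSum.degree_eq_of_mem_mem forms hn hg.mem_forms hg.ne_zero, Nat.cast_le]
  exact Nat.sInf_le ⟨g, mem_forms_natCast.1 hg.mem_forms, hg.colon_eq⟩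

theorem IsIndicator.eval_ne_zero (hg : IsIndicator P i g) {e : ℤ} (hh : h ∈ forms e)
    (hreg : ∀ x, h * x ∈ vanishingIdeal (Set.range P) → x ∈ vanishingIdeal (Set.range P)) :
    eval (P i).rep h ≠ 0 := by
  intro h0
  refine hg.2.1 ((mem_vanishingIdeal_iff_of_mem_forms hg.mem_forms).1 (hreg g ?_) _ ⟨i, rfl⟩)
  rw [mem_vanishingIdeal_iff_of_mem_forms (SetLike.GradedMul.mul_mem hh hg.mem_forms)]
  rintro _ ⟨j, rfl⟩
  rw [map_mul]
  obtain rfl | hji := eq_or_ne j i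
  · rw [h0, zero_mul]
  · rw [hg.2.2 j hji, mul_zero]

theorem IsIndicator.X_mul_mem (hg : IsIndicator P i g) (hh : h ∈ forms 1)
    (hi : eval (P i).rep h ≠ 0) (k : Fin s) :
    X k * g ∈ vanishingIdeal (Set.range P) ⊔ Ideal.span {h} := by
  have hl : X k - C ((P i).rep k / eval (P i).rep h) * h ∈ forms 1 :=
    sub_mem (X_mem_forms_one k) (SetLike.GradedMul.mul_mem (C_mem_forms_zero _) hh)
  have hlg : (X k - C ((P i).rep k / eval (P i).rep h) * h) * g ∈
      vanishingIdeal (Set.range P) := by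
    rw [mem_vanishingIdeal_iff_of_mem_forms (SetLike.GradedMul.mul_mem hl hg.mem_forms)]
    rintro _ ⟨j, rfl⟩
    rw [map_mul]
    obtain rfl | hji := eq_or_ne j i
    · simp [hi]
    · rw [hg.2.2 j hji, mul_zero]
  refine sup_comm (vanishingIdeal (Set.range P)) _ ▸ Ideal.mem_span_singleton_sup.2
    ⟨C ((P i).rep k / eval (P i).rep h) * g, _, hlg, ?_⟩
  ring

theorem IsIndicator.notMem_sup_span_singleton (hg : IsIndicator P i g)
    (hdeg : g.totalDegree = vNumber (vanishingIdeal (Set.range P)) (vanishingIdeal {P i}))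
    (hh : h ∈ forms 1) (hP : ∀ j, eval (P j).rep h ≠ 0) :
    g ∉ vanishingIdeal (Set.range P) ⊔ Ideal.span {h} := by
  intro hmem
  obtain ⟨w, hw, hgw⟩ := exists_mem_forms_sub_mul_mem (isHomogeneous_vanishingIdeal _) hh
    hg.mem_forms hmem
  have heval (j : Fin m) : eval (P j).rep g = eval (P j).rep h * eval (P j).rep w := by
    have hhw := SetLike.GradedMul.mul_mem hh hw
    rw [add_sub_cancel] at hhw
    rw [← sub_eq_zero, ← map_mul, ← map_sub]
    exact (mem_vanishingIdeal_iff_of_mem_forms (sub_mem hg.mem_forms hhw)).1 hgw _ ⟨j, rfl⟩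
  have hwi : IsIndicator P i w := by
    refine ⟨exists_isHomogeneous_of_mem_forms hw, fun h0 => hg.2.1 ?_, fun j hji => ?_⟩
    · rw [heval, h0, mul_zero]
    · exact (mul_eq_zero.1 ((heval j).symm.trans (hg.2.2 j hji))).resolve_left (hP j)
  have hle := hwi.vNumber_le hw
  omega

/-- Lagrange interpolation: subtract from a form the combination of the `h ^ (j - deg fᵢ) * fᵢ` with
the same values. -/
theorem forms_le_vanishingIdeal_sup_span_singleton {f : Fin m → MvPolynomial (Fin s) K}
    (hf : ∀ i, IsIndicator P i (f i)) (hh : h ∈ forms 1) (hP : ∀ j, eval (P j).rep h ≠ 0) {d : ℕ}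
    (hd : ∀ i, (f i).totalDegree ≤ d) {j : ℤ} (hj : d < j) :
    forms j ≤ (vanishingIdeal (Set.range P) ⊔ Ideal.span {h}).restrictScalars K := by
  intro g hg
  lift j to ℕ using by omega
  have hlt (i : Fin m) : (f i).totalDegree < j := (hd i).trans_lt (by exact_mod_cast hj)
  let c (i : Fin m) : K :=
    eval (P i).rep g / (eval (P i).rep h ^ (j - (f i).totalDegree) * eval (P i).rep (f i))
  let q := ∑ i, C (c i) * (h ^ (j - (f i).totalDegree) * f i)
  have hq : q ∈ forms (j : ℤ) := mem_forms_natCast.2 <| IsHomogeneous.sum _ _ _ fun i _ => by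
    have hh1 : h.IsHomogeneous 1 := mem_forms_natCast.1 hh
    have hmul := (hh1.pow (j - (f i).totalDegree)).mul (mem_forms_natCast.1 (hf i).mem_forms)
    rw [one_mul, Nat.sub_add_cancel (hlt i).le] at hmul
    exact hmul.C_mul (c i)
  have hqh : q ∈ Ideal.span {h} := Ideal.sum_mem _ fun i _ => Ideal.mul_mem_left _ _ <|
    Ideal.mul_mem_right _ _ <| Ideal.pow_mem_of_mem _ (Ideal.mem_span_singleton_self h) _
      (Nat.sub_pos_of_lt (hlt i))
  have hgq : g - q ∈ vanishingIdeal (Set.range P) := by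
    rw [mem_vanishingIdeal_iff_of_mem_forms (sub_mem hg hq)]
    rintro _ ⟨k, rfl⟩
    rw [map_sub, map_sum, Finset.sum_eq_single_of_mem k (Finset.mem_univ k) fun i _ hik => by
      rw [map_mul, map_mul, (hf i).2.2 k hik.symm, mul_zero, mul_zero]]
    rw [map_mul, eval_C, map_mul, map_pow, div_mul_cancel₀, sub_self]
    exact mul_ne_zero (pow_ne_zero _ (hP k)) (hf k).2.1
  rw [← sub_add_cancel g q]
  exact Submodule.add_mem_sup hgq hqh

theorem nonempty_of_isGorenstein (hG : IsGorenstein (vanishingIdeal (Set.range P))) :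
    Nonempty (Fin m) := by
  by_contra hm
  rw [not_nonempty_iff, ← Set.range_eq_empty_iff (f := P)] at hm
  obtain ⟨F⟩ := hG.nonempty_minGradedFreeResolution
  exact F.ne_top (hm ▸ vanishingIdeal_empty)

end Indicators

end ProjPoints

open ProjPoints MvPolynomial in
theorem mainTheorem9_general {K : Type*} [Field K] {s m : ℕ}
    (ord : MonomialOrder (Fin s)) (P : Fin m → ℙ K (Fin s → K))
    (I : Ideal (MvPolynomial (Fin s) K)) (hI : I = vanishingIdeal (Set.range P))
    (hG : IsGorenstein I)
    (h : MvPolynomial (Fin s) K) (hh : h.IsHomogeneous 1)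
    (hreg : IsSMulRegular (MvPolynomial (Fin s) K ⧸ I) h)
    (J : Ideal (MvPolynomial (Fin s) K)) (hJ : J = I ⊔ Ideal.span {h})
    (f : Fin m → MvPolynomial (Fin s) K)
    (hf : ∀ i, IsIndicator P i (f i))
    (hdeg : ∀ i, (f i).totalDegree = vNumber I (vanishingIdeal {P i})) :
    ∃ a : Fin s →₀ ℕ,
      footprintDeg ord J (regularity I) = {a} ∧
      (∀ i, (f i).totalDegree = regularity I) ∧
      (∀ i, (socle J).restrictScalars K =
        Submodule.span K {Ideal.Quotient.mk J (f i)}) ∧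
      (socle J).restrictScalars K =
        Submodule.span K {Ideal.Quotient.mk J (monomial a (1 : K))} ∧
      ∀ i, ∃ c : K, c ≠ 0 ∧
        ∀ r, IsRemainder ord J (f i) r ↔ r = monomial a c := by
  subst hI hJ
  have hh' : h ∈ forms 1 := mem_forms_natCast.2 hh
  have hreg' (x) : h * x ∈ vanishingIdeal (Set.range P) → x ∈ vanishingIdeal (Set.range P) :=
    mem_of_isSMulRegular_quotient_of_smul_mem hreg
  have hP0 (i) : eval (P i).rep h ≠ 0 := (hf i).eval_ne_zero hh' hreg'
  have hfJ (i) : f i ∉ vanishingIdeal (Set.range P) ⊔ Ideal.span {h} :=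
    (hf i).notMem_sup_span_singleton (hdeg i) hh' hP0
  have := nonempty_of_isGorenstein hG
  obtain ⟨i₀, hi₀⟩ := Finite.exists_max fun i => (f i).totalDegree
  obtain ⟨hregularity, hJ⟩ := hG.isArtinianGorenstein (isHomogeneous_vanishingIdeal _) hh' hreg'
    (fun j hj => forms_le_vanishingIdeal_sup_span_singleton hf hh' hP0 hi₀ hj)
    (hf i₀).mem_forms (hfJ i₀)
  rw [← hregularity] at hJ
  have hfdeg (i) : (f i).totalDegree = regularity (vanishingIdeal (Set.range P)) :=
    Nat.cast_injective (hJ.eq_of_mem_forms (hf i).mem_forms (hfJ i)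
      ((hf i).X_mul_mem hh' (hP0 i)))
  have hfreg (i) : f i ∈ forms (regularity (vanishingIdeal (Set.range P)) : ℤ) :=
    hfdeg i ▸ (hf i).mem_forms
  obtain ⟨a, ha⟩ := hJ.exists_footprintDeg_eq_singleton ord
  have ha' : a ∈ footprintDeg ord _ _ := ha ▸ Set.mem_singleton a
  exact ⟨a, ha, hfdeg, fun i => hJ.socle_eq_span (hfreg i) (hfJ i),
    hJ.socle_eq_span (monomial_mem_forms ha'.2 1) (monomial_notMem_of_mem_footprint ha'.1),
    fun i => hJ.exists_isRemainder_iff ha' (hfreg i) (hfJ i)⟩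

theorem mainTheorem9 {K : Type*} [Field K] [Finite K] {s m : ℕ} (hm : 2 ≤ m)
    (ord : MonomialOrder (Fin s)) (hord : ProjPoints.IsGradedOrder ord)
    (P : Fin m → ℙ K (Fin s → K)) (hP : Function.Injective P)
    (I : Ideal (MvPolynomial (Fin s) K)) (hI : I = ProjPoints.vanishingIdeal (Set.range P))
    (hG : ProjPoints.IsGorenstein I)
    (h : MvPolynomial (Fin s) K) (hh : h.IsHomogeneous 1)
    (hreg : IsSMulRegular (MvPolynomial (Fin s) K ⧸ I) h)
    (J : Ideal (MvPolynomial (Fin s) K)) (hJ : J = I ⊔ Ideal.span {h})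
    (f : Fin m → MvPolynomial (Fin s) K)
    (hf : ∀ i, ProjPoints.IsStandardIndicator ord P i (f i)) :
    ∃ a : Fin s →₀ ℕ,
      ProjPoints.footprintDeg ord J (ProjPoints.regularity I) = {a} ∧
      (∀ i, (f i).totalDegree = ProjPoints.regularity I) ∧
      (∀ i, (ProjPoints.socle J).restrictScalars K =
        Submodule.span K {Ideal.Quotient.mk J (f i)}) ∧
      (ProjPoints.socle J).restrictScalars K =
        Submodule.span K {Ideal.Quotient.mk J (MvPolynomial.monomial a (1 : K))} ∧
      ∀ i, ∃ c : K, c ≠ 0 ∧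
        ∀ r, ProjPoints.IsRemainder ord J (f i) r ↔ r = MvPolynomial.monomial a c := by
  subst hI
  exact mainTheorem9_general ord P _ rfl hG h hh hreg J hJ f (fun i => (hf i).1) fun i => (hf i).2.2
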